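/- Let $E$ be a Dedekind complete (real) vector lattice with a weak order unit $e$. A conditional expectation on $E$ is a linear operator $T:E\to E$ that is a strictly positive (i.e. $Tx\ge 0$ for $x\ge 0$, and $x\geq 0$, $Tx=0$ imply $x=0$), order continuous projection whose range is a Dedekind complete Riesz subspace and which fixes some weak order unit. Let $T$ be a conditional expectation on $E$ with $Te=e$, and let $(T_n)_{n\ge 1}$ be a filtration with $T_1=T$, that is, a sequence of conditional expectations on $E$ with $T_iT_j=T_jT_i=T_{\min(i,j)}$ for all $i,j\ge 1$. Let $(f_n)_{n\ge1}$ be a martingale, i.e. a sequence in $E$ with $T_nf_{n+1}=f_n$ for all $n\ge 1$, and assume that it is $T$-bounded, i.e. there is $M\in E$ with $T|f_n|\le M$ for all $n$. Let $E^u$ be the universal completion of $E$ (the Dedekind complete and laterally complete vector lattice that contains $E$ as an order dense Riesz subspace) and let $(E^u)_s$ be the sup-completion of $E^u$, in which every nonempty subset has a supremum. Then the maximal function $$f^*:=\sup_{n\ge 1}|f_n|,$$ where the supremum is taken in $(E^u)_s$, belongs to $E^u$. -/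

import Mathlib

namespace RieszSpace

/-- A weak order unit: a positive element `e` whose only disjoint element is `0`. -/
def IsWeakOrderUnit {E : Type*} [Lattice E] [AddCommGroup E] (e : E) : Prop :=
  0 ≤ e ∧ ∀ x : E, e ⊓ |x| = 0 → x = 0

/-- Order continuity of a positive operator: `T D ↓ 0` for every downward directed `D ↓ 0`. -/
def IsOrderContinuous {E : Type*} [Lattice E] [AddCommGroup E] [Module ℝ E]
    (T : E →ₗ[ℝ] E) : Prop :=
  ∀ D : Set E, D.Nonempty → DirectedOn (· ≥ ·) D → IsGLB D 0 → IsGLB (T '' D) 0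

/-- A conditional expectation operator: a strictly positive order continuous projection onto a
Dedekind complete Riesz subspace, which fixes some weak order unit. -/
structure IsConditionalExpectation {E : Type*} [Lattice E] [AddCommGroup E] [Module ℝ E]
    (T : E →ₗ[ℝ] E) : Prop where
  nonneg : ∀ x : E, 0 ≤ x → 0 ≤ T x
  strictly_pos : ∀ x : E, 0 ≤ x → T x = 0 → x = 0
  order_continuous : IsOrderContinuous T
  idempotent : ∀ x : E, T (T x) = T x
  range_sup : ∀ x y : E, T x ⊔ T y ∈ Set.range T
  range_inf : ∀ x y : E, T x ⊓ T y ∈ Set.range T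
  range_dedekind_complete : ∀ A : Set (Set.range T), A.Nonempty → BddAbove A → ∃ s, IsLUB A s
  exists_fixed_unit : ∃ e : E, IsWeakOrderUnit e ∧ T e = e

/-- A filtration starting at `T`: conditional expectations `S 0 = T, S 1, S 2, …` with
`S i ∘ S j = S (min i j)`. (The index starts at `0`.) -/
structure IsFiltration {E : Type*} [Lattice E] [AddCommGroup E] [Module ℝ E]
    (T : E →ₗ[ℝ] E) (S : ℕ → E →ₗ[ℝ] E) : Prop where
  condExp : ∀ n, IsConditionalExpectation (S n)
  zero_eq : S 0 = T
  comp_eq : ∀ i j x, S i (S j x) = S (min i j) x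

/-- `(f n)` is a martingale with respect to `(S n)`. -/
def IsMartingale {E : Type*} [Lattice E] [AddCommGroup E] [Module ℝ E]
    (S : ℕ → E →ₗ[ℝ] E) (f : ℕ → E) : Prop :=
  ∀ n, S n (f (n + 1)) = f n

/-- `(f n)` is `T`-bounded: the sequence `(T |f n|)` is order bounded in `E`. -/
def IsTBounded {E : Type*} [Lattice E] [AddCommGroup E] [Module ℝ E]
    (T : E →ₗ[ℝ] E) (f : ℕ → E) : Prop :=
  ∃ M : E, ∀ n, T |f n| ≤ M

/-- Lateral completeness: every nonempty set of mutually disjoint positive elements has a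
supremum. -/
def IsLaterallyComplete (U : Type*) [Lattice U] [AddCommGroup U] : Prop :=
  ∀ A : Set U, A.Nonempty → (∀ a ∈ A, 0 ≤ a) → (∀ a ∈ A, ∀ b ∈ A, a ≠ b → a ⊓ b = 0) →
    ∃ s, IsLUB A s

/-- `U`, together with the embedding `j : E → U`, is a universal completion of `E`: `U` is
universally complete (Dedekind complete and laterally complete) and `j` is a Riesz isomorphism
of `E` onto an order dense Riesz subspace of `U`. Universal completions are unique up to a Riesz
isomorphism that fixes `E`. -/
structure IsUniversalCompletion {E U : Type*} [Lattice E] [AddCommGroup E] [Module ℝ E]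
    [ConditionallyCompleteLattice U] [AddCommGroup U] [Module ℝ U] (j : E →ₗ[ℝ] U) : Prop where
  laterally_complete : IsLaterallyComplete U
  injective : Function.Injective j
  map_sup : ∀ x y : E, j (x ⊔ y) = j x ⊔ j y
  map_inf : ∀ x y : E, j (x ⊓ y) = j x ⊓ j y
  order_dense : ∀ u : U, 0 < u → ∃ x : E, 0 < j x ∧ j x ≤ u

/-- The sup-completion of a Dedekind complete Riesz space `U`, as an ordered set. An element `x`
of it is represented by the set of all `y` in `U` with `y ≤ x`; the sets which occur are the
nonempty lower sets that are closed under all suprema which exist in `U`. -/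
@[ext]
structure SupCompletion (U : Type*) [Lattice U] where
  carrier : Set U
  nonempty : carrier.Nonempty
  lower : IsLowerSet carrier
  sup_mem : ∀ (B : Set U) (s : U), B ⊆ carrier → B.Nonempty → IsLUB B s → s ∈ carrier

namespace SupCompletion

variable {U : Type*} [Lattice U]

instance : PartialOrder (SupCompletion U) :=
  PartialOrder.lift carrier fun _ _ h => SupCompletion.ext h

theorem le_def {x y : SupCompletion U} : x ≤ y ↔ x.carrier ⊆ y.carrier := Iff.rfl

/-- The canonical embedding of `U` into its sup-completion. -/
def of (u : U) : SupCompletion U where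
  carrier := Set.Iic u
  nonempty := ⟨u, le_refl u⟩
  lower := isLowerSet_Iic u
  sup_mem := fun _ _ hB _ hs => hs.2 fun _ hb => hB hb

theorem of_le_iff {u : U} {x : SupCompletion U} : of u ≤ x ↔ u ∈ x.carrier :=
  ⟨fun h => h (le_refl u), fun h _ hv => x.lower hv h⟩

theorem of_le_of {u v : U} : of u ≤ of v ↔ u ≤ v := of_le_iff

/-- The supremum, in the sup-completion, of a nonempty family. -/
def sup {I : Type*} [Nonempty I] (F : I → SupCompletion U) : SupCompletion U where
  carrier := {u | ∀ y : SupCompletion U, (∀ i, F i ≤ y) → u ∈ y.carrier}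
  nonempty :=
    let ⟨u, hu⟩ := (F (Classical.arbitrary I)).nonempty
    ⟨u, fun _ hy => hy _ hu⟩
  lower := fun _ _ hba ha y hy => y.lower hba (ha y hy)
  sup_mem := fun B s hB hne hs y hy => y.sup_mem B s (fun _ hb => hB hb y hy) hne hs

theorem isLUB_sup {I : Type*} [Nonempty I] (F : I → SupCompletion U) :
    IsLUB (Set.range F) (sup F) := by
  constructor
  · rintro _ ⟨i, rfl⟩ u hu y hy
    exact hy i hu
  · intro y hy u hu
    exact hu y fun i => hy ⟨i, rfl⟩

/-- Every element is the supremum of the elements of `U` below it. -/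
theorem isLUB_of_le (x : SupCompletion U) : IsLUB (of '' {u | of u ≤ x}) x := by
  constructor
  · rintro _ ⟨u, hu, rfl⟩
    exact hu
  · intro y hy u hu
    exact of_le_iff.1 (hy ⟨u, of_le_iff.2 hu, rfl⟩)

end SupCompletion

/-- The maximal function `f* = sup |f n|`, formed in the sup-completion of `U`, of a sequence in
`E`, where `E` is embedded in `U` by `j`. -/
def maximalFunction {E U : Type*} [AddCommGroup E] [Module ℝ E] [Lattice U] [AddCommGroup U]
    [Module ℝ U] (j : E →ₗ[ℝ] U) (f : ℕ → E) : SupCompletion U :=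
  SupCompletion.sup fun n => SupCompletion.of |j (f n)|

end RieszSpace

/-! The proof carries Doob's weak type inequality over to band projections. For a level `l`, split
`e` into the layers where `|f k|` first exceeds `l • e`. `S k` commutes with the projection onto
layer `k` (`map_layer`), so there `l • e ≤ |f k| ≤ S k |f N|`; applying `T` and summing over `k`
gives `l • T (e - r l) ≤ M`, where `r l` is the part of `e` on which no `|f i|` exceeds `l • e`.

If `z ≥ 0` is disjoint from every `r l`, then `l • T (z ⊓ e) ≤ M` for all `l`, hence `T (z ⊓ e) = 0`
and `z = 0` by strict positivity. So the `r l` generate everything. Cutting `e` into disjoint layers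
along them, with `|f i| ≤ n • e` on the `n`-th, lateral completeness of `U` glues the bounds into
one element dominating every `j |f i|`. -/

namespace RieszSpace

set_option linter.unusedSectionVars false

/-! ### Disjoint elements and suprema in lattice ordered groups. -/

section Disjointness

variable {E : Type*} [Lattice E] [AddCommGroup E] [IsOrderedAddMonoid E]

theorem add_inf_le_add_inf {x y z : E} (hx : 0 ≤ x) (hy : 0 ≤ y) (hz : 0 ≤ z) :
    (x + y) ⊓ z ≤ x ⊓ z + y ⊓ z := by
  rw [add_inf, inf_add, inf_add]
  refine le_inf (le_inf inf_le_left ?_) (le_inf ?_ ?_)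
  · exact inf_le_right.trans (le_add_of_nonneg_right hy)
  · exact inf_le_right.trans (le_add_of_nonneg_left hx)
  · exact inf_le_right.trans (le_add_of_nonneg_left hz)

theorem add_inf_eq_zero {x y z : E} (hx : 0 ≤ x) (hy : 0 ≤ y) (hz : 0 ≤ z)
    (hxz : x ⊓ z = 0) (hyz : y ⊓ z = 0) : (x + y) ⊓ z = 0 := by
  refine le_antisymm ?_ (le_inf (add_nonneg hx hy) hz)
  simpa [hxz, hyz] using add_inf_le_add_inf hx hy hz

theorem nsmul_inf_eq_zero {x z : E} (hx : 0 ≤ x) (hz : 0 ≤ z) (h : x ⊓ z = 0) (n : ℕ) :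
    (n • x) ⊓ z = 0 := by
  induction n with
  | zero => simpa using hz
  | succ n ih =>
    rw [succ_nsmul]
    exact add_inf_eq_zero (nsmul_nonneg hx n) hx hz ih h

theorem inf_eq_zero_mono {x y z w : E} (hx : 0 ≤ x) (hz : 0 ≤ z) (hxy : x ≤ y) (hzw : z ≤ w)
    (h : y ⊓ w = 0) : x ⊓ z = 0 :=
  le_antisymm (h ▸ inf_le_inf hxy hzw) (le_inf hx hz)

theorem add_eq_sup_of_inf_eq_zero {x y : E} (h : x ⊓ y = 0) : x + y = x ⊔ y := by
  rw [← inf_add_sup x y, h, zero_add]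

/-- Disjointness turns `y i + b` into `y i ⊔ b ≤ s ⊔ b`; passing to the supremum gives `s + b ≤ s ⊔
b`, which forces `s ⊓ b ≤ 0`. -/
theorem inf_eq_zero_of_isLUB {ι : Type*} {y : ι → E} {s b : E} (hs : IsLUB (Set.range y) s)
    (hs0 : 0 ≤ s) (hb : 0 ≤ b) (h : ∀ i, y i ⊓ b = 0) : s ⊓ b = 0 := by
  refine le_antisymm ?_ (le_inf hs0 hb)
  have key : s ≤ s ⊔ b - b := by
    refine hs.2 ?_
    rintro _ ⟨i, rfl⟩
    rw [le_sub_iff_add_le, add_eq_sup_of_inf_eq_zero (h i)]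
    exact sup_le_sup_right (hs.1 ⟨i, rfl⟩) b
  rw [le_sub_iff_add_le, ← inf_add_sup s b] at key
  simpa using key

theorem isLUB_add {x y : ℕ → E} (hx : Monotone x) (hy : Monotone y) {s t : E}
    (hs : IsLUB (Set.range x) s) (ht : IsLUB (Set.range y) t) :
    IsLUB (Set.range fun n => x n + y n) (s + t) := by
  refine ⟨?_, fun w hw => ?_⟩
  · rintro _ ⟨n, rfl⟩
    exact add_le_add (hs.1 ⟨n, rfl⟩) (ht.1 ⟨n, rfl⟩)
  · rw [← le_sub_iff_add_le]
    refine hs.2 ?_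
    rintro _ ⟨m, rfl⟩
    rw [le_sub_comm]
    refine ht.2 ?_
    rintro _ ⟨n, rfl⟩
    rw [le_sub_iff_add_le']
    exact (add_le_add (hx (le_max_left m n)) (hy (le_max_right m n))).trans (hw ⟨_, rfl⟩)

theorem isLUB_nsmul {x : ℕ → E} (hx : Monotone x) {s : E} (hs : IsLUB (Set.range x) s) (k : ℕ) :
    IsLUB (Set.range fun n => k • x n) (k • s) := by
  induction k with
  | zero => simp
  | succ k ih =>
    simp only [succ_nsmul]
    exact isLUB_add (fun m n h => nsmul_le_nsmul_right (hx h) k) hx ih hs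

theorem sum_range_le_of_pairwise_inf_eq_zero {a : ℕ → E} {u : E} (hu : 0 ≤ u)
    (ha : ∀ n, 0 ≤ a n) (hd : ∀ m n, m < n → a m ⊓ a n = 0) (hau : ∀ n, a n ≤ u) (N : ℕ) :
    ∑ n ∈ Finset.range N, a n ≤ u := by
  have hdis : ∀ k N, N ≤ k → (∑ n ∈ Finset.range N, a n) ⊓ a k = 0 := by
    intro k N
    induction N with
    | zero => intro _; simpa using ha k
    | succ N ih =>
      intro h
      rw [Finset.sum_range_succ]
      exact add_inf_eq_zero (Finset.sum_nonneg fun n _ => ha n) (ha N) (ha k)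
        (ih (Nat.le_of_succ_le h)) (hd _ _ h)
  induction N with
  | zero => simpa using hu
  | succ N ih =>
    rw [Finset.sum_range_succ, add_eq_sup_of_inf_eq_zero (hdis N N le_rfl)]
    exact sup_le ih (hau N)

end Disjointness

/-! ### Band projections and successive decomposition along a sequence of bands. -/

section BandPart

variable {E : Type*} [ConditionallyCompleteLattice E] [AddCommGroup E]

/-- For positive `x` and `b`, the component of `x` in the band generated by `b`. -/
noncomputable def bandPart (b x : E) : E := ⨆ n : ℕ, x ⊓ n • b

theorem bddAbove_range_inf_nsmul (b x : E) : BddAbove (Set.range fun n : ℕ => x ⊓ n • b) :=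
  ⟨x, by rintro _ ⟨n, rfl⟩; exact inf_le_left⟩

theorem isLUB_bandPart (b x : E) : IsLUB (Set.range fun n : ℕ => x ⊓ n • b) (bandPart b x) :=
  isLUB_ciSup (bddAbove_range_inf_nsmul b x)

theorem inf_nsmul_le_bandPart (b x : E) (n : ℕ) : x ⊓ n • b ≤ bandPart b x :=
  (isLUB_bandPart b x).1 ⟨n, rfl⟩

theorem bandPart_le_iff {b x y : E} : bandPart b x ≤ y ↔ ∀ n : ℕ, x ⊓ n • b ≤ y := by
  rw [isLUB_le_iff (isLUB_bandPart b x)]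
  exact ⟨fun h n => h ⟨n, rfl⟩, by rintro h _ ⟨n, rfl⟩; exact h n⟩

theorem bandPart_le (b x : E) : bandPart b x ≤ x := bandPart_le_iff.2 fun _ => inf_le_left

theorem bandPart_mono (b : E) {x y : E} (h : x ≤ y) : bandPart b x ≤ bandPart b y :=
  bandPart_le_iff.2 fun n => (inf_le_inf_right _ h).trans (inf_nsmul_le_bandPart b y n)

theorem bandPart_nonneg (b : E) {x : E} (hx : 0 ≤ x) : 0 ≤ bandPart b x := by
  simpa [hx] using inf_nsmul_le_bandPart b x 0

variable [IsOrderedAddMonoid E]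

/-- A conditionally complete lattice ordered group is Archimedean. -/
theorem nonpos_of_forall_nsmul_le {w M : E} (h : ∀ n : ℕ, n • w ≤ M) : w ≤ 0 := by
  have hlub : IsLUB (Set.range fun n : ℕ => n • w) (⨆ n : ℕ, n • w) :=
    isLUB_ciSup ⟨M, by rintro _ ⟨n, rfl⟩; exact h n⟩
  have key : (⨆ n : ℕ, n • w) ≤ (⨆ n : ℕ, n • w) - w := by
    refine hlub.2 ?_
    rintro _ ⟨n, rfl⟩
    rw [le_sub_iff_add_le]
    exact (succ_nsmul w n).symm.le.trans (hlub.1 ⟨n + 1, rfl⟩)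
  simpa using key

theorem bandPart_add {b x y : E} (hb : 0 ≤ b) (hx : 0 ≤ x) (hy : 0 ≤ y) :
    bandPart b (x + y) = bandPart b x + bandPart b y := by
  apply le_antisymm
  · refine bandPart_le_iff.2 fun n => ?_
    exact (add_inf_le_add_inf hx hy (nsmul_nonneg hb n)).trans
      (add_le_add (inf_nsmul_le_bandPart b x n) (inf_nsmul_le_bandPart b y n))
  · rw [← le_sub_iff_add_le]
    refine bandPart_le_iff.2 fun n => ?_
    rw [le_sub_comm]
    refine bandPart_le_iff.2 fun m => ?_
    rw [le_sub_iff_add_le]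
    refine le_trans (le_inf ?_ ?_) (inf_nsmul_le_bandPart b (x + y) (m + n))
    · rw [add_comm x y]
      exact add_le_add inf_le_left inf_le_left
    · rw [add_nsmul]
      exact add_le_add inf_le_right inf_le_right

/-- Adding the infimum `z` to `x ⊓ n • b` stays below both `x` and `(n + 1) • b`, so `bandPart b x`
absorbs `z`. -/
theorem sub_bandPart_inf_eq_zero {b x : E} (hb : 0 ≤ b) : (x - bandPart b x) ⊓ b = 0 := by
  refine le_antisymm ?_ (le_inf (sub_nonneg.2 (bandPart_le b x)) hb)
  set z := (x - bandPart b x) ⊓ b with hz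
  have h1 : bandPart b x + z ≤ x := by
    rw [← le_sub_iff_add_le']; exact inf_le_left
  have key : bandPart b x ≤ bandPart b x - z := by
    refine bandPart_le_iff.2 fun n => ?_
    rw [le_sub_iff_add_le]
    refine le_trans (le_inf ?_ ?_) (inf_nsmul_le_bandPart b x (n + 1))
    · exact (add_le_add_left (inf_nsmul_le_bandPart b x n) z).trans h1
    · rw [succ_nsmul]
      exact add_le_add inf_le_right inf_le_right
  simpa using key

theorem bandPart_eq_zero {b x : E} (hb : 0 ≤ b) (hx : 0 ≤ x) (h : x ⊓ b = 0) :
    bandPart b x = 0 := by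
  refine le_antisymm (bandPart_le_iff.2 fun n => ?_) (bandPart_nonneg b hx)
  rw [inf_comm] at h ⊢
  exact (nsmul_inf_eq_zero hb hx h n).le

theorem bandPart_inf_eq_zero {b x z : E} (hb : 0 ≤ b) (hx : 0 ≤ x) (hz : 0 ≤ z)
    (h : b ⊓ z = 0) : bandPart b x ⊓ z = 0 := by
  refine inf_eq_zero_of_isLUB (isLUB_bandPart b x) (bandPart_nonneg b hx) hz fun n => ?_
  exact inf_eq_zero_mono (le_inf hx (nsmul_nonneg hb n)) hz inf_le_right le_rfl
    (nsmul_inf_eq_zero hb hz h n)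

theorem bandPart_eq_self {b x : E} {n : ℕ} (h : x ≤ n • b) : bandPart b x = x :=
  le_antisymm (bandPart_le b x) <| by
    simpa [inf_eq_left.2 h] using inf_nsmul_le_bandPart b x n

theorem bandPart_nsmul {b x : E} (hb : 0 ≤ b) (hx : 0 ≤ x) (n : ℕ) :
    bandPart b (n • x) = n • bandPart b x := by
  induction n with
  | zero => simpa using bandPart_eq_zero hb le_rfl (by simpa using hb)
  | succ n ih => rw [succ_nsmul, succ_nsmul, bandPart_add hb (nsmul_nonneg hx n) hx, ih]

theorem sub_bandPart_mono {b x y : E} (hb : 0 ≤ b) (hx : 0 ≤ x) (h : x ≤ y) :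
    x - bandPart b x ≤ y - bandPart b y := by
  have h1 := bandPart_add hb hx (sub_nonneg.2 h)
  rw [add_sub_cancel] at h1
  rw [h1]
  have h2 := bandPart_le b (y - x)
  rw [sub_le_sub_iff]
  calc x + (bandPart b x + bandPart b (y - x)) ≤ x + (bandPart b x + (y - x)) := by gcongr
    _ = y + bandPart b x := by abel

theorem bandPart_weakOrderUnit {e x : E} (he : IsWeakOrderUnit e) : bandPart e x = x := by
  have h0 : 0 ≤ x - bandPart e x := sub_nonneg.2 (bandPart_le e x)
  have := he.2 (x - bandPart e x) (by
    rw [abs_of_nonneg h0, inf_comm]; exact sub_bandPart_inf_eq_zero he.1)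
  exact (sub_eq_zero.1 this).symm

/-- The part of `x` which is left after removing successively its components in the bands
generated by `b 0, …, b (n - 1)`. -/
noncomputable def residual (b : ℕ → E) : ℕ → E → E
  | 0, x => x
  | n + 1, x => residual b n x - bandPart (b n) (residual b n x)

/-- The component of `x` in the band generated by `b n`, after removal of its components in the
bands generated by `b 0, …, b (n - 1)`. -/
noncomputable def layer (b : ℕ → E) (n : ℕ) (x : E) : E := bandPart (b n) (residual b n x)

theorem residual_succ (b : ℕ → E) (n : ℕ) (x : E) :
    residual b (n + 1) x = residual b n x - layer b n x := rfl

theorem residual_nonneg (b : ℕ → E) {x : E} (hx : 0 ≤ x) (n : ℕ) : 0 ≤ residual b n x := by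
  cases n with
  | zero => exact hx
  | succ n => exact sub_nonneg.2 (bandPart_le _ _)

theorem layer_nonneg (b : ℕ → E) {x : E} (hx : 0 ≤ x) (n : ℕ) : 0 ≤ layer b n x :=
  bandPart_nonneg _ (residual_nonneg b hx n)

theorem residual_antitone (b : ℕ → E) {x : E} (hx : 0 ≤ x) :
    Antitone fun n => residual b n x :=
  antitone_nat_of_succ_le fun n => by
    rw [residual_succ]; exact sub_le_self _ (layer_nonneg b hx n)

theorem residual_le (b : ℕ → E) {x : E} (hx : 0 ≤ x) (n : ℕ) : residual b n x ≤ x :=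
  residual_antitone b hx (Nat.zero_le n)

theorem residual_inf_eq_zero {b : ℕ → E} (hb : ∀ n, 0 ≤ b n) {x : E} (hx : 0 ≤ x) {i n : ℕ}
    (h : i < n) : residual b n x ⊓ b i = 0 :=
  inf_eq_zero_mono (residual_nonneg b hx n) (hb i) (residual_antitone b hx h) le_rfl
    (sub_bandPart_inf_eq_zero (hb i))

theorem residual_add {b : ℕ → E} (hb : ∀ n, 0 ≤ b n) {x y : E} (hx : 0 ≤ x) (hy : 0 ≤ y)
    (n : ℕ) : residual b n (x + y) = residual b n x + residual b n y := by
  induction n with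
  | zero => rfl
  | succ n ih =>
    simp only [residual, ih]
    rw [bandPart_add (hb n) (residual_nonneg b hx n) (residual_nonneg b hy n)]
    abel

theorem layer_add {b : ℕ → E} (hb : ∀ n, 0 ≤ b n) {x y : E} (hx : 0 ≤ x) (hy : 0 ≤ y)
    (n : ℕ) : layer b n (x + y) = layer b n x + layer b n y := by
  rw [layer, residual_add hb hx hy,
    bandPart_add (hb n) (residual_nonneg b hx n) (residual_nonneg b hy n), layer, layer]

theorem layer_mono {b : ℕ → E} (hb : ∀ n, 0 ≤ b n) {x y : E} (hx : 0 ≤ x) (h : x ≤ y)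
    (n : ℕ) : layer b n x ≤ layer b n y := by
  have h1 := layer_add hb hx (sub_nonneg.2 h) n
  rw [add_sub_cancel] at h1
  rw [h1]
  exact le_add_of_nonneg_right (layer_nonneg b (sub_nonneg.2 h) n)

theorem layer_nsmul {b : ℕ → E} (hb : ∀ n, 0 ≤ b n) {x : E} (hx : 0 ≤ x) (n k : ℕ) :
    layer b n (k • x) = k • layer b n x := by
  induction k with
  | zero =>
    have := layer_add hb (le_refl (0 : E)) le_rfl n
    simpa using this
  | succ k ih => rw [succ_nsmul, succ_nsmul, layer_add hb (nsmul_nonneg hx k) hx, ih]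

theorem layer_eq_zero {b : ℕ → E} (hb : ∀ n, 0 ≤ b n) {x : E} (hx : 0 ≤ x) {n : ℕ}
    (h : x ⊓ b n = 0) : layer b n x = 0 :=
  bandPart_eq_zero (hb n) (residual_nonneg b hx n)
    (inf_eq_zero_mono (residual_nonneg b hx n) (hb n) (residual_le b hx n) le_rfl h)

theorem layer_inf_layer_eq_zero {b : ℕ → E} (hb : ∀ n, 0 ≤ b n) {x y : E} (hx : 0 ≤ x)
    (hy : 0 ≤ y) {m n : ℕ} (h : m < n) : layer b m x ⊓ layer b n y = 0 := by
  refine bandPart_inf_eq_zero (hb m) (residual_nonneg b hx m) (layer_nonneg b hy n) ?_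
  rw [inf_comm]
  exact inf_eq_zero_mono (layer_nonneg b hy n) (hb m) (bandPart_le _ _) le_rfl
    (residual_inf_eq_zero hb hy h)

theorem sum_layer (b : ℕ → E) (x : E) (N : ℕ) :
    ∑ n ∈ Finset.range N, layer b n x = x - residual b N x := by
  induction N with
  | zero => simp [residual]
  | succ N ih => rw [Finset.sum_range_succ, ih, residual_succ]; abel

end BandPart

/-! ### Conditional expectations commute with projections onto bands of fixed elements. -/

section ConditionalExpectation

variable {E : Type*} [ConditionallyCompleteLattice E] [AddCommGroup E] [IsOrderedAddMonoid E]
  [Module ℝ E] {S : E →ₗ[ℝ] E}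

namespace IsConditionalExpectation

theorem mono (hS : IsConditionalExpectation S) {x y : E} (h : x ≤ y) : S x ≤ S y := by
  have := hS.nonneg _ (sub_nonneg.2 h)
  rwa [map_sub, sub_nonneg] at this

theorem abs_map_le (hS : IsConditionalExpectation S) (x : E) : |S x| ≤ S |x| :=
  abs_le'.2 ⟨hS.mono (le_abs_self x), by rw [← map_neg]; exact hS.mono (neg_le_abs x)⟩

/-- The range is a sublattice, and `S` is the identity on it. -/
theorem map_sup_of_fixed (hS : IsConditionalExpectation S) {x y : E} (hx : S x = x)
    (hy : S y = y) : S (x ⊔ y) = x ⊔ y := by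
  obtain ⟨z, hz⟩ := hS.range_sup x y
  rw [hx, hy] at hz
  rw [← hz, hS.idempotent]

theorem map_abs_of_fixed (hS : IsConditionalExpectation S) {x : E} (hx : S x = x) :
    S |x| = |x| :=
  hS.map_sup_of_fixed hx (by rw [map_neg, hx])

theorem map_posPart_of_fixed (hS : IsConditionalExpectation S) {x : E} (hx : S x = x) :
    S x⁺ = x⁺ :=
  hS.map_sup_of_fixed hx (map_zero S)

theorem isLUB_map (hS : IsConditionalExpectation S) {x : ℕ → E} (hx : Monotone x) {s : E}
    (hs : IsLUB (Set.range x) s) : IsLUB (Set.range fun n => S (x n)) (S s) := by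
  have h := hS.order_continuous (Set.range fun n => s - x n) (Set.range_nonempty _)
    (by
      rintro _ ⟨m, rfl⟩ _ ⟨n, rfl⟩
      exact ⟨_, ⟨max m n, rfl⟩, sub_le_sub_left (hx (le_max_left m n)) s,
        sub_le_sub_left (hx (le_max_right m n)) s⟩)
    (by
      constructor
      · rintro _ ⟨n, rfl⟩
        exact sub_nonneg.2 (hs.1 ⟨n, rfl⟩)
      · intro y hy
        have : s ≤ s - y := hs.2 (by
          rintro _ ⟨n, rfl⟩
          exact le_sub_comm.1 (hy ⟨n, rfl⟩))
        simpa using this)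
  constructor
  · rintro _ ⟨n, rfl⟩
    exact hS.mono (hs.1 ⟨n, rfl⟩)
  · intro y hy
    have : S s - y ≤ 0 := h.2 (by
      rintro _ ⟨_, ⟨n, rfl⟩, rfl⟩
      rw [map_sub]
      exact sub_le_sub_left (hy ⟨n, rfl⟩) _)
    exact sub_nonpos.1 this

theorem isLUB_map_inf_nsmul (hS : IsConditionalExpectation S) {b : E} (hb : 0 ≤ b) (x : E) :
    IsLUB (Set.range fun n : ℕ => S (x ⊓ n • b)) (S (bandPart b x)) :=
  hS.isLUB_map (fun _ _ h => inf_le_inf_left x (nsmul_le_nsmul_left hb h)) (isLUB_bandPart b x)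

/-- Each `y ⊓ n • e` lies below `n • (e - bandPart b e)`, which is fixed by `S` and disjoint from
`b`. Order continuity then lets `n` grow. -/
theorem map_inf_eq_zero (hS : IsConditionalExpectation S) {e : E} (he : IsWeakOrderUnit e)
    (hSe : S e = e) {b y : E} (hb : 0 ≤ b) (hSb : S b = b) (hy : 0 ≤ y) (h : y ⊓ b = 0) :
    S y ⊓ b = 0 := by
  have hfix : S (bandPart b e) = bandPart b e := by
    have h1 := hS.isLUB_map_inf_nsmul hb e
    have h2 : ∀ n : ℕ, S (e ⊓ n • b) = e ⊓ n • b := fun n => by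
      obtain ⟨z, hz⟩ := hS.range_inf e (n • b)
      rw [map_nsmul, hSe, hSb] at hz
      rw [← hz, hS.idempotent]
    simp only [h2] at h1
    exact h1.unique (isLUB_bandPart b e)
  have hlub := hS.isLUB_map_inf_nsmul he.1 y
  rw [bandPart_weakOrderUnit he] at hlub
  refine inf_eq_zero_of_isLUB hlub (hS.nonneg _ hy) hb fun n => ?_
  have hz : 0 ≤ y ⊓ n • e := le_inf hy (nsmul_nonneg he.1 n)
  have h1 : y ⊓ n • e ≤ n • (e - bandPart b e) := by
    have h2 := sub_bandPart_mono hb hz (inf_le_right : y ⊓ n • e ≤ n • e)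
    rwa [bandPart_eq_zero hb hz (inf_eq_zero_mono hz hb inf_le_left le_rfl h), sub_zero,
      bandPart_nsmul hb he.1, ← nsmul_sub] at h2
  have h3 := hS.mono h1
  rw [map_nsmul, map_sub, hSe, hfix] at h3
  exact inf_eq_zero_mono (hS.nonneg _ hz) hb h3 le_rfl
    (nsmul_inf_eq_zero (sub_nonneg.2 (bandPart_le b e)) hb (sub_bandPart_inf_eq_zero hb) n)

/-- A conditional expectation commutes with the projections onto the bands generated by the
positive elements of its range. -/
theorem map_bandPart (hS : IsConditionalExpectation S) {e : E} (he : IsWeakOrderUnit e)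
    (hSe : S e = e) {b x : E} (hb : 0 ≤ b) (hSb : S b = b) (hx : 0 ≤ x) :
    S (bandPart b x) = bandPart b (S x) := by
  have hr : 0 ≤ x - bandPart b x := sub_nonneg.2 (bandPart_le b x)
  apply le_antisymm
  · refine (isLUB_le_iff (hS.isLUB_map_inf_nsmul hb x)).2 ?_
    rintro _ ⟨n, rfl⟩
    have h1 : S (x ⊓ n • b) ≤ n • b := by
      have := hS.mono (inf_le_right : x ⊓ n • b ≤ n • b)
      rwa [map_nsmul, hSb] at this
    change S (x ⊓ n • b) ≤ _
    -- Being at most `n • b`, this image already lies in the band of `b`.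
    rw [← bandPart_eq_self h1]
    exact bandPart_mono b (hS.mono inf_le_left)
  · have h1 : S x = S (bandPart b x) + S (x - bandPart b x) := by rw [← map_add, add_sub_cancel]
    rw [h1, bandPart_add hb (hS.nonneg _ (bandPart_nonneg b hx)) (hS.nonneg _ hr),
      bandPart_eq_zero hb (hS.nonneg _ hr)
        (hS.map_inf_eq_zero he hSe hb hSb hr (sub_bandPart_inf_eq_zero hb)), add_zero]
    exact bandPart_le _ _

theorem map_residual (hS : IsConditionalExpectation S) {e : E} (he : IsWeakOrderUnit e)
    (hSe : S e = e) {b : ℕ → E} (hb : ∀ n, 0 ≤ b n) {x : E} (hx : 0 ≤ x) {n : ℕ}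
    (hSb : ∀ i < n, S (b i) = b i) : S (residual b n x) = residual b n (S x) := by
  induction n with
  | zero => rfl
  | succ n ih =>
    simp only [residual]
    rw [map_sub, hS.map_bandPart he hSe (hb n) (hSb n n.lt_succ_self) (residual_nonneg b hx n),
      ih fun i hi => hSb i (hi.trans n.lt_succ_self)]

theorem map_layer (hS : IsConditionalExpectation S) {e : E} (he : IsWeakOrderUnit e)
    (hSe : S e = e) {b : ℕ → E} (hb : ∀ n, 0 ≤ b n) {x : E} (hx : 0 ≤ x) {n : ℕ}
    (hSb : ∀ i ≤ n, S (b i) = b i) : S (layer b n x) = layer b n (S x) := by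
  rw [layer, hS.map_bandPart he hSe (hb n) (hSb n le_rfl) (residual_nonneg b hx n),
    hS.map_residual he hSe hb hx fun i hi => hSb i hi.le, layer]

end IsConditionalExpectation

end ConditionalExpectation

/-! ### The weak type maximal inequality. -/

section Martingale

variable {E : Type*} [ConditionallyCompleteLattice E] [AddCommGroup E] [IsOrderedAddMonoid E]
  [Module ℝ E] {T : E →ₗ[ℝ] E} {S : ℕ → E →ₗ[ℝ] E} {f : ℕ → E}

theorem IsMartingale.map_of_le (hS : IsFiltration T S) (hf : IsMartingale S f) {k n : ℕ}
    (h : k ≤ n) : S k (f n) = f k := by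
  induction n, h using Nat.le_induction with
  | base => rw [← hf k, (hS.condExp k).idempotent]
  | succ n h ih => rw [← ih, ← hf n, hS.comp_eq, min_eq_left h]

theorem IsMartingale.map_of_ge (hS : IsFiltration T S) (hf : IsMartingale S f) {k n : ℕ}
    (h : n ≤ k) : S k (f n) = f n := by
  rw [← hf.map_of_le hS le_rfl, hS.comp_eq, min_eq_right h]

theorem IsFiltration.map_of_map_eq (hS : IsFiltration T S) {x : E} (hx : T x = x) (k : ℕ) :
    S k x = x := by
  rw [← hx, ← hS.zero_eq, hS.comp_eq, min_eq_right (Nat.zero_le k)]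

theorem IsFiltration.map_map (hS : IsFiltration T S) (k : ℕ) (x : E) : T (S k x) = T x := by
  rw [← hS.zero_eq, hS.comp_eq, min_eq_left (Nat.zero_le k)]

/-- The weak type maximal inequality for martingales at the level `l • e`. -/
theorem IsMartingale.nsmul_map_sub_residual_le (hT : IsConditionalExpectation T)
    (hS : IsFiltration T S) (hf : IsMartingale S f) {e : E} (he : IsWeakOrderUnit e)
    (hTe : T e = e) (l N : ℕ) :
    l • T (e - residual (fun i => (|f i| - l • e)⁺) N e) ≤ T |f N| := by
  set b : ℕ → E := fun i => (|f i| - l • e)⁺ with hbdef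
  have hb : ∀ n, 0 ≤ b n := fun n => posPart_nonneg _
  have hle : 0 ≤ l • e := nsmul_nonneg he.1 l
  have hSb : ∀ k, ∀ i ≤ k, S k (b i) = b i := fun k i hi =>
    (hS.condExp k).map_posPart_of_fixed (by
      rw [map_sub, map_nsmul, hS.map_of_map_eq hTe,
        (hS.condExp k).map_abs_of_fixed (hf.map_of_ge hS hi)])
  have hstep : ∀ k ∈ Finset.range N, T (l • layer b k e) ≤ T (layer b k |f N|) := by
    intro k hk
    -- The negative part of `|f k| - l • e` is disjoint from `b k`, so layer `k` does not see it.
    have h1 : l • layer b k e ≤ layer b k |f k| := by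
      have hdis : (|f k| - l • e)⁻ ⊓ b k = 0 := by
        rw [inf_comm]; exact posPart_inf_negPart_eq_zero _
      have hsum : |f k| + (|f k| - l • e)⁻ = l • e + b k := by
        have := posPart_sub_negPart (|f k| - l • e)
        rw [sub_eq_sub_iff_add_eq_add] at this
        rw [← this, add_comm]
      have h2 := congrArg (layer b k) hsum
      rw [layer_add hb (abs_nonneg _) (negPart_nonneg _), layer_add hb hle (hb k),
        layer_eq_zero hb (negPart_nonneg _) hdis, add_zero, layer_nsmul hb he.1] at h2
      rw [h2]
      exact le_add_of_nonneg_right (layer_nonneg b (hb k) k)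
    have h2 : |f k| ≤ S k |f N| := by
      rw [← hf.map_of_le hS (Finset.mem_range.1 hk).le]
      exact (hS.condExp k).abs_map_le _
    have h3 := hT.mono (h1.trans (layer_mono hb (abs_nonneg _) h2 k))
    rwa [← (hS.condExp k).map_layer he (hS.map_of_map_eq hTe k) hb (abs_nonneg _) (hSb k),
      hS.map_map] at h3
  have hsum := Finset.sum_le_sum hstep
  -- Both sums of layers telescope.
  rw [← map_sum, ← map_sum, ← Finset.smul_sum, sum_layer, sum_layer, map_nsmul] at hsum
  exact hsum.trans (hT.mono (sub_le_self _ (residual_nonneg b (abs_nonneg _) N)))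

/-- A `T`-bounded martingale is uniformly bounded by `l • e` off a small component of `e`. -/
theorem IsMartingale.exists_component (hT : IsConditionalExpectation T)
    (hS : IsFiltration T S) (hf : IsMartingale S f) {e : E} (he : IsWeakOrderUnit e)
    (hTe : T e = e) {M : E} (hM : ∀ n, T |f n| ≤ M) (l : ℕ) :
    ∃ r : E, 0 ≤ r ∧ r ≤ e ∧ l • T (e - r) ≤ M ∧ ∀ i, (|f i| - l • e)⁺ ⊓ r = 0 := by
  set b : ℕ → E := fun i => (|f i| - l • e)⁺ with hbdef
  have hb : ∀ n, 0 ≤ b n := fun n => posPart_nonneg _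
  have hbdd : BddBelow (Set.range fun N => residual b N e) :=
    ⟨0, by rintro _ ⟨N, rfl⟩; exact residual_nonneg b he.1 N⟩
  have hglb := isGLB_ciInf hbdd
  set r := ⨅ N, residual b N e with hr
  have hr0 : 0 ≤ r := hglb.2 (by rintro _ ⟨N, rfl⟩; exact residual_nonneg b he.1 N)
  have hrN : ∀ N, r ≤ residual b N e := fun N => hglb.1 ⟨N, rfl⟩
  refine ⟨r, hr0, hrN 0, ?_, fun i => ?_⟩
  · have hlub : IsLUB (Set.range fun N => l • (e - residual b N e)) (l • (e - r)) := by
      refine isLUB_nsmul (fun m n h => sub_le_sub_left (residual_antitone b he.1 h) e) ?_ l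
      refine ⟨?_, fun w hw => ?_⟩
      · rintro _ ⟨N, rfl⟩
        exact sub_le_sub_left (hrN N) e
      · refine sub_le_comm.1 (hglb.2 ?_)
        rintro _ ⟨N, rfl⟩
        exact sub_le_comm.1 (hw ⟨N, rfl⟩)
    have h1 := hT.isLUB_map (fun m n h =>
      nsmul_le_nsmul_right (sub_le_sub_left (residual_antitone b he.1 h) e) l) hlub
    rw [← map_nsmul]
    refine (isLUB_le_iff h1).2 ?_
    rintro _ ⟨N, rfl⟩
    change T (l • _) ≤ M
    rw [map_nsmul]
    exact (hf.nsmul_map_sub_residual_le hT hS he hTe l N).trans (hM N)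
  · rw [inf_comm]
    exact inf_eq_zero_mono hr0 (hb i) (hrN (i + 1)) le_rfl
      (residual_inf_eq_zero hb he.1 i.lt_succ_self)

end Martingale

/-! ### Gluing bounds in the universal completion. -/

section UniversalCompletion

variable {E U : Type*} [ConditionallyCompleteLattice E] [AddCommGroup E] [IsOrderedAddMonoid E]
  [Module ℝ E] [ConditionallyCompleteLattice U] [AddCommGroup U] [IsOrderedAddMonoid U]
  [Module ℝ U] {j : E →ₗ[ℝ] U}

namespace IsUniversalCompletion

theorem le_iff (hj : IsUniversalCompletion j) {x y : E} : j x ≤ j y ↔ x ≤ y := by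
  rw [← sup_eq_right, ← hj.map_sup, hj.injective.eq_iff, sup_eq_right]

theorem nonneg (hj : IsUniversalCompletion j) {x : E} (hx : 0 ≤ x) : 0 ≤ j x := by
  rw [← map_zero j]; exact hj.le_iff.2 hx

theorem map_abs (hj : IsUniversalCompletion j) (x : E) : j |x| = |j x| := by
  rw [abs, hj.map_sup, map_neg, abs]

/-- The embedding into the universal completion preserves infima equal to `0`. -/
theorem nonpos_of_forall_le (hj : IsUniversalCompletion j) {ι : Type*} {x : ι → E}
    (hx : ∀ y, 0 ≤ y → (∀ i, y ≤ x i) → y = 0) {v : U} (hv : ∀ i, v ≤ j (x i))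
    (hx0 : ∀ i, 0 ≤ x i) : v ≤ 0 := by
  by_contra hcon
  have hpos : 0 < v⁺ := lt_of_le_of_ne (posPart_nonneg v) fun h => hcon (posPart_eq_zero.1 h.symm)
  obtain ⟨y, hy, hyv⟩ := hj.order_dense _ hpos
  have hy0 : 0 ≤ y := by rw [← map_zero j] at hy; exact hj.le_iff.1 hy.le
  have : y = 0 := hx y hy0 fun i =>
    hj.le_iff.1 (hyv.trans (sup_le (hv i) (hj.nonneg (hx0 i))))
  simp [this] at hy

/-- A set of positive elements is bounded in the universal completion if it is uniformly bounded
by `n • e` in the band generated by `r n`, where the `r n` together generate the whole space. -/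
theorem exists_upper_bound (hj : IsUniversalCompletion j) {e : E} (he : 0 ≤ e) {r : ℕ → E}
    (hr : ∀ n, 0 ≤ r n) (hfull : ∀ z, 0 ≤ z → (∀ n, z ⊓ r n = 0) → z = 0) :
    ∃ u : U, ∀ x : E, 0 ≤ x → (∀ n : ℕ, (x - n • e)⁺ ⊓ r n = 0) → j x ≤ u := by
  -- An admissible `x` is at most `n • e` on layer `n`, so `a n` bounds it there.
  set a : ℕ → E := fun n => n • layer r n e with ha
  have hl0 : ∀ n, 0 ≤ layer r n e := fun n => layer_nonneg r he n
  have ha0 : ∀ n, 0 ≤ a n := fun n => nsmul_nonneg (hl0 n) n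
  have hd : ∀ m n, m < n → j (a m) ⊓ j (a n) = 0 := by
    intro m n h
    rw [← hj.map_inf, ← map_zero j]
    congr 1
    refine nsmul_inf_eq_zero (hl0 m) (ha0 n) ?_ m
    rw [inf_comm]
    refine nsmul_inf_eq_zero (hl0 n) (hl0 m) ?_ n
    rw [inf_comm]
    exact layer_inf_layer_eq_zero hr he he h
  obtain ⟨u, hu⟩ := hj.laterally_complete (Set.range fun n => j (a n)) (Set.range_nonempty _)
    (by rintro _ ⟨n, rfl⟩; exact hj.nonneg (ha0 n))
    (by
      rintro _ ⟨m, rfl⟩ _ ⟨n, rfl⟩ hne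
      rcases lt_trichotomy m n with h | rfl | h
      · exact hd m n h
      · exact absurd rfl hne
      · rw [inf_comm]; exact hd n m h)
  have hau : ∀ n, j (a n) ≤ u := fun n => hu.1 ⟨n, rfl⟩
  have hu0 : 0 ≤ u := (hj.nonneg (ha0 0)).trans (hau 0)
  refine ⟨u, fun x hx hxr => sub_nonpos.1 ?_⟩
  -- `j x - u` lies below every `j (residual r N x)`, and fullness of the `r n` makes these
  -- residuals decrease to `0`.
  refine hj.nonpos_of_forall_le (x := fun N => residual r N x) (fun y hy hyN => ?_) (fun N => ?_)
    (residual_nonneg r hx)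
  · exact hfull y hy fun n => inf_eq_zero_mono hy (hr n) (hyN (n + 1)) le_rfl
      (residual_inf_eq_zero hr hx n.lt_succ_self)
  · have hlayer : ∀ n, layer r n x ≤ a n := fun n => by
      have h1 : x ≤ n • e + (x - n • e)⁺ := by
        rw [← sub_le_iff_le_add']; exact le_posPart _
      have h2 := layer_mono hr hx h1 n
      rwa [layer_add hr (nsmul_nonneg he n) (posPart_nonneg _),
        layer_eq_zero hr (posPart_nonneg _) (hxr n), add_zero, layer_nsmul hr he] at h2
    have h1 : x - residual r N x ≤ ∑ n ∈ Finset.range N, a n :=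
      (sum_layer r x N).symm.le.trans (Finset.sum_le_sum fun n _ => hlayer n)
    have h2 := hj.le_iff.2 h1
    rw [map_sub, map_sum] at h2
    rw [sub_le_comm]
    exact h2.trans (sum_range_le_of_pairwise_inf_eq_zero hu0 (fun n => hj.nonneg (ha0 n)) hd hau N)

end IsUniversalCompletion

/-- Carriers are closed under suprema existing in `U`, so the supremum in `U` is also the one in the
sup-completion. -/
theorem maximalFunction_mem_range_of {f : ℕ → E} (h : BddAbove (Set.range fun n => |j (f n)|)) :
    maximalFunction j f ∈ Set.range (SupCompletion.of (U := U)) := by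
  refine ⟨⨆ n, |j (f n)|, le_antisymm (SupCompletion.of_le_iff.2 fun y hy => ?_) ?_⟩
  · refine y.sup_mem (Set.range fun n => |j (f n)|) _ ?_ (Set.range_nonempty _) (isLUB_ciSup h)
    rintro _ ⟨n, rfl⟩
    exact SupCompletion.of_le_iff.1 (hy n)
  · refine (SupCompletion.isLUB_sup _).2 ?_
    rintro _ ⟨n, rfl⟩
    exact SupCompletion.of_le_of.2 (le_ciSup h n)

end UniversalCompletion

end RieszSpace

theorem mainTheorem6 {E U : Type*}
    [ConditionallyCompleteLattice E] [AddCommGroup E] [IsOrderedAddMonoid E]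
    [Module ℝ E] [IsOrderedModule ℝ E]
    [ConditionallyCompleteLattice U] [AddCommGroup U] [IsOrderedAddMonoid U]
    [Module ℝ U] [IsOrderedModule ℝ U]
    (j : E →ₗ[ℝ] U) (hj : RieszSpace.IsUniversalCompletion j)
    (e : E) (he : RieszSpace.IsWeakOrderUnit e)
    (T : E →ₗ[ℝ] E) (hT : RieszSpace.IsConditionalExpectation T) (hTe : T e = e)
    (S : ℕ → E →ₗ[ℝ] E) (hS : RieszSpace.IsFiltration T S)
    (f : ℕ → E) (hf : RieszSpace.IsMartingale S f) (hbdd : RieszSpace.IsTBounded T f) :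
    RieszSpace.maximalFunction j f ∈ Set.range (RieszSpace.SupCompletion.of (U := U)) := by
  obtain ⟨M, hM⟩ := hbdd
  choose r hr0 hre hrM hrd using hf.exists_component hT hS he hTe hM
  obtain ⟨u, hu⟩ := hj.exists_upper_bound he.1 hr0 (fun z hz hzr => by
    have hw0 : 0 ≤ z ⊓ e := le_inf hz he.1
    -- `z ⊓ e` and `r n` are disjoint and both below `e`, so their sum, being their supremum, is
    -- too.
    have hle : ∀ n, z ⊓ e ≤ e - r n := fun n => by
      rw [le_sub_iff_add_le, RieszSpace.add_eq_sup_of_inf_eq_zero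
        (RieszSpace.inf_eq_zero_mono hw0 (hr0 n) inf_le_left le_rfl (hzr n))]
      exact sup_le inf_le_right (hre n)
    have hT0 : T (z ⊓ e) ≤ 0 := RieszSpace.nonpos_of_forall_nsmul_le (M := M) fun n =>
      (nsmul_le_nsmul_right (hT.mono (hle n)) n).trans (hrM n)
    refine he.2 z ?_
    rw [abs_of_nonneg hz, inf_comm]
    exact hT.strictly_pos _ hw0 (le_antisymm hT0 (hT.nonneg _ hw0)))
  refine RieszSpace.maximalFunction_mem_range_of ⟨u, ?_⟩
  rintro _ ⟨i, rfl⟩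
  change |j (f i)| ≤ u
  rw [← hj.map_abs]
  exact hu _ (abs_nonneg _) fun n => hrd n i
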